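/- Let $M,m\ge 1$ be integers and $\Delta,c_0>0$. Let $a_n,\tau_n:\mathbb Z\to\mathbb R$ ($1\le n\le M$) be amplitudes and time shifts given by $2Mm$ values each, i.e. periodic of period $2Mm$. For real-valued Schwartz functions $f_1,\dots,f_M$ on $\mathbb R^2$ let $$d(t,j)=\sum_{n=1}^M a_n(j)\,f_n(t+\tau_n(j),\Delta j),\qquad t\in\mathbb R,\ j\in\mathbb Z,$$ be the recorded data, and let $\mathcal F(f)(\omega,k)=\iint f(t,x)e^{-2\pi i(t\omega+xk)}\,dt\,dx$. Put $$\mathcal C=\{(\omega,k):|\omega|>c_0|k|\},\qquad \mathcal D=\mathcal C\setminus\Big\{(\omega,k):|\omega|\ge c_0\big|k+\tfrac1{M\Delta}\big|\ \text{or}\ |\omega|\ge c_0\big|k-\tfrac1{M\Delta}\big|\Big\}.$$ Say that the spectra are uniquely determined on a set $\mathcal E$ if, whenever $(f_n)$ and $(g_n)$ satisfy $\operatorname{supp}\mathcal F(f_n),\operatorname{supp}\mathcal F(g_n)\subset\mathcal C$ for all $n$ and have the same data, $\mathcal F(f_n)=\mathcal F(g_n)$ on $\mathcal E$ for all $n$.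 Let $\mathcal E\subset\mathcal C$ be a (Lebesgue measurable) set on which the spectra are uniquely determined. Then the area of $\mathcal E$ is at most the area of $\mathcal D$. If the areas are equal, then: 1. $\mathcal E=\mathcal D$ up to a set of measure zero, and $\mathcal E\subset\overline{\mathcal D}$; moreover the spectra are uniquely determined on $\mathcal D$, and if $\mathcal E$ is open and maximal among the open subsets of $\mathcal C$ on which the spectra are uniquely determined, then $\mathcal E=\mathcal D$ exactly. 2. The encoding is of apparition style: for all $n,n',j$ one has $a_n(j+M)a_{n'}(j)=a_n(j)a_{n'}(j+M)$, and if this number is nonzero then $\tau_n(j+M)-\tau_{n'}(j+M)=\tau_n(j)-\tau_{n'}(j)$. In particular, if the first source is normalized by $a_1\equiv1$, $\tau_1\equiv0$, then every $a_n$ is periodic of period $M$, and $\tau_n(j+M)=\tau_n(j)$ whenever $a_n(j)\ne0$. -/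

import Mathlib

open MeasureTheory
open scoped SchwartzMap FourierTransform

namespace SimSource

/-- The plane, with Lebesgue measure. Points are read as `(t, x)` (time, position along the line)
or as `(ω, k)` (frequency, wavenumber). -/
abbrev Plane : Type := EuclideanSpace ℝ (Fin 2)

/-- The temporal and spatial Fourier transform
`(ω, k) ↦ ∫∫ f (t, x) exp (-2 π i (t ω + x k)) dt dx` of real data `f`. -/
noncomputable def spectrum (f : 𝓢(Plane, ℝ)) : Plane → ℂ :=
  𝓕 (fun v : Plane => (f v : ℂ))

/-- The signal cone `|ω| > c₀ |k|`. -/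
def cone (c₀ : ℝ) : Set Plane := {p | c₀ * |p 1| < |p 0|}

/-- The diamond: the cone with the two closed cones centred at `k = ± 1 / (M Δ)` removed. -/
def diamond (M : ℕ) (Δ c₀ : ℝ) : Set Plane :=
  cone c₀ \ {p | c₀ * |p 1 + 1 / (M * Δ)| ≤ |p 0| ∨ c₀ * |p 1 - 1 / (M * Δ)| ≤ |p 0|}

/-- The recorded data `d (t, j) = ∑ₙ aₙ(j) fₙ(t + τₙ(j), Δ j)`; source number `1` of the usual
numbering is the index `0 : Fin M`. -/
noncomputable def recorded {M : ℕ} (Δ : ℝ) (a τ : Fin M → ℤ → ℝ) (f : Fin M → 𝓢(Plane, ℝ))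
    (t : ℝ) (j : ℤ) : ℝ :=
  ∑ n, a n j * f n !₂[t + τ n j, Δ * j]

/-- All sources have the (closed) support of their spectrum inside the cone. -/
def Admissible {M : ℕ} (c₀ : ℝ) (f : Fin M → 𝓢(Plane, ℝ)) : Prop :=
  ∀ n, tsupport (spectrum (f n)) ⊆ cone c₀

/-- The values of all the spectra on `E` are uniquely determined by the recorded data: two
admissible families of sources with the same data have the same spectra on `E`. -/
def UniquelyDeterminedOn {M : ℕ} (Δ c₀ : ℝ) (a τ : Fin M → ℤ → ℝ) (E : Set Plane) : Prop :=
  ∀ f g : Fin M → 𝓢(Plane, ℝ), Admissible c₀ f → Admissible c₀ g →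
    (∀ t j, recorded Δ a τ f t j = recorded Δ a τ g t j) →
    ∀ n, ∀ p ∈ E, spectrum (f n) p = spectrum (g n) p

/-- The amplitudes and the time shifts are periodic of period `M`. A time shift `τₙ(j)` whose
amplitude `aₙ(j)` is zero does not enter the data, so nothing is said about it. -/
def PeriodicEncoding {M : ℕ} (a τ : Fin M → ℤ → ℝ) : Prop :=
  ∀ n j, a n (j + M) = a n j ∧ (a n j ≠ 0 → τ n (j + M) = τ n j)

/-- The encoding of the sources relative to each other is periodic of period `M`: every ratio
`aₙ / aₙ'` and every difference `τₙ - τₙ'` is, the former in the form without division, the latter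
where the amplitudes involved do not vanish. (Multiplying all `aₙ(j)` by a common nonzero factor
`α(j)` and adding a common `σ(j)` to all `τₙ(j)` only rescales and shifts the `j`-th trace.) -/
def RelativelyPeriodicEncoding {M : ℕ} (a τ : Fin M → ℤ → ℝ) : Prop :=
  ∀ n n' j, a n (j + M) * a n' j = a n j * a n' (j + M) ∧
    (a n j * a n' (j + M) ≠ 0 → τ n (j + M) - τ n' (j + M) = τ n j - τ n' j)

end SimSource

namespace SimSource

open Filter Topology

/-- The algebra of entire functions. -/
def entire : Subalgebra ℂ (ℂ → ℂ) where
  carrier := {f | Differentiable ℂ f}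
  mul_mem' hf hg := Differentiable.mul hf hg
  add_mem' hf hg := Differentiable.add hf hg
  algebraMap_mem' c := differentiable_const c

/-! ### Entire functions: an integral domain with null real zero sets -/

namespace entire

theorem differentiable (f : entire) : Differentiable ℂ (f : ℂ → ℂ) := f.2

theorem analyticOnNhd (f : entire) : AnalyticOnNhd ℂ (f : ℂ → ℂ) Set.univ :=
  fun z _ => (differentiable f).analyticAt z

@[ext] theorem ext {f g : entire} (h : ∀ z, (f : ℂ → ℂ) z = (g : ℂ → ℂ) z) : f = g :=
  Subtype.ext (funext h)

@[simp] theorem coe_algebraMap (c z : ℂ) : ((algebraMap ℂ entire c : entire) : ℂ → ℂ) z = c := rfl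

/-- Evaluation at a point. -/
def eval (z : ℂ) : entire →+* ℂ := (Pi.evalRingHom (fun _ : ℂ => ℂ) z).comp entire.val.toRingHom

@[simp] theorem eval_apply (z : ℂ) (f : entire) : eval z f = (f : ℂ → ℂ) z := rfl

instance : IsDomain entire := by
  have : NoZeroDivisors entire := ⟨by
    intro f g h
    have h' : ∀ z ∈ Set.univ, (f : ℂ → ℂ) z * (g : ℂ → ℂ) z = 0 := fun z _ => by
      have := congrArg (eval z) h
      simpa using this
    rcases AnalyticOnNhd.eq_zero_or_eq_zero_of_mul_eq_zero (analyticOnNhd f) (analyticOnNhd g) h'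
      isPreconnected_univ with h0 | h0
    · exact Or.inl (ext fun z => h0 z trivial)
    · exact Or.inr (ext fun z => h0 z trivial)⟩
  have : Nontrivial entire := ⟨0, 1, fun h => by simpa using congrArg (eval 0) h⟩
  exact NoZeroDivisors.to_isDomain _

theorem eventually_ne_zero {f : entire} (hf : f ≠ 0) (z : ℂ) :
    ∀ᶠ u in 𝓝[≠] z, (f : ℂ → ℂ) u ≠ 0 := by
  by_contra h
  exact hf (ext fun u => (analyticOnNhd f).eqOn_zero_of_preconnected_of_frequently_eq_zero
    isPreconnected_univ (Set.mem_univ z) h (Set.mem_univ u))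

theorem ae_ne_zero {f : entire} (hf : f ≠ 0) : ∀ᵐ ω : ℝ, (f : ℂ → ℂ) ω ≠ 0 := by
  have h : {ω : ℝ | (f : ℂ → ℂ) ω ≠ 0} ∈ codiscreteWithin (Set.univ : Set ℝ) := by
    rw [mem_codiscreteWithin_iff_forall_mem_nhdsNE]
    intro ω _
    have ht : Tendsto (fun x : ℝ => (x : ℂ)) (𝓝[≠] ω) (𝓝[≠] (ω : ℂ)) :=
      tendsto_nhdsWithin_iff.2 ⟨(Complex.continuous_ofReal.tendsto ω).mono_left inf_le_left,
        eventually_nhdsWithin_of_forall fun x hx => by simpa using hx⟩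
    filter_upwards [ht.eventually (eventually_ne_zero hf ω)] with x hx
    exact Or.inl hx
  have := ae_restrict_le_codiscreteWithin (μ := (volume : Measure ℝ)) MeasurableSet.univ h
  rwa [Measure.restrict_univ] at this

theorem eq_zero_of_forall_Ioo {f : entire} {α β : ℝ} (hαβ : α < β)
    (h : ∀ ω : ℝ, α < ω → ω < β → (f : ℂ → ℂ) ω = 0) : f = 0 := by
  by_contra hf
  have h0 : volume (Set.Ioo α β) = 0 :=
    measure_mono_null (fun ω hω => by simpa using h ω hω.1 hω.2) (ae_ne_zero hf)
  simp only [Real.volume_Ioo, ENNReal.ofReal_eq_zero] at h0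
  linarith

/-- The function `z ↦ z - c`. -/
def subConst (c : ℂ) : entire := ⟨fun z => z - c, differentiable_id.sub_const c⟩

theorem subConst_ne_zero (c : ℂ) : subConst c ≠ 0 := fun h => by
  simpa [subConst] using congrArg (eval (c + 1)) h

theorem subConst_dvd_iff {c : ℂ} {f : entire} : subConst c ∣ f ↔ (f : ℂ → ℂ) c = 0 := by
  constructor
  · rintro ⟨g, rfl⟩
    simp [subConst]
  · intro h
    refine ⟨⟨dslope (f : ℂ → ℂ) c, ?_⟩, ?_⟩
    · exact differentiableOn_univ.1 <|
        (Complex.differentiableOn_dslope univ_mem).2 (differentiable f).differentiableOn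
    · ext z
      have := sub_smul_dslope (f : ℂ → ℂ) c z
      simp only [h, sub_zero, smul_eq_mul] at this
      exact this.symm

theorem exists_not_subConst_pow_dvd {f : entire} (hf : f ≠ 0) (c : ℂ) :
    ∃ n, ¬ subConst c ^ n ∣ f := by
  have hfin : analyticOrderAt (f : ℂ → ℂ) c ≠ ⊤ := by
    rw [Ne, analyticOrderAt_eq_top]
    intro h
    obtain ⟨u, hu, hu'⟩ := ((eventually_ne_zero hf c).and (h.filter_mono inf_le_left)).exists
    exact hu hu'
  obtain ⟨n, hn⟩ := ENat.ne_top_iff_exists.1 hfin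
  refine ⟨n + 1, ?_⟩
  rintro ⟨g, hg⟩
  have : ((n + 1 : ℕ) : ℕ∞) ≤ analyticOrderAt (f : ℂ → ℂ) c := by
    rw [natCast_le_analyticOrderAt ((differentiable f).analyticAt c)]
    refine ⟨g, (differentiable g).analyticAt c, Eventually.of_forall fun z => ?_⟩
    have := congrArg (eval z) hg
    simpa [subConst] using this
  rw [← hn] at this
  exact absurd (by exact_mod_cast this) (Nat.not_succ_le_self n)

theorem contDiff_comp_ofReal (f : entire) : ContDiff ℝ (⊤ : ℕ∞) fun ω : ℝ => (f : ℂ → ℂ) ω :=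
  (((differentiable f).contDiff (n := (⊤ : ℕ∞))).restrict_scalars ℝ).comp Complex.ofRealCLM.contDiff

end entire

/-! ### Linear algebra over a domain -/

/-- A homogeneous linear system with more unknowns than equations has a nonzero solution. -/
theorem exists_ne_zero_mulVec_eq_zero {R ρ κ : Type*} [CommRing R] [Nontrivial R] [Fintype ρ]
    [Fintype κ] (h : Fintype.card ρ < Fintype.card κ) (A : Matrix ρ κ R) :
    ∃ x : κ → R, x ≠ 0 ∧ A.mulVec x = 0 := by
  by_contra! hc
  have : Function.Injective A.mulVecLin := by
    rw [← LinearMap.ker_eq_bot, LinearMap.ker_eq_bot']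
    intro x hx
    by_contra hx0
    exact hc x hx0 hx
  exact absurd (card_le_of_injective R A.mulVecLin this) (not_le.2 h)

/-- Left eigenvectors `A r`, `r ∈ ℤ`, of an `M × M` matrix, with eigenvalues that are periodic in
`r` of period `M` and distinct otherwise: `A (r + M)` is parallel to `A r`. -/
theorem eigenvectors_parallel {R : Type*} [CommRing R] [IsDomain R] {M : ℕ}
    [NeZero M] (X : Matrix (Fin M) (Fin M) R) (A : ℤ → Fin M → R) (μ : ℤ → R)
    (hA : ∀ r, A r ≠ 0) (hX : ∀ r, Matrix.vecMul (A r) X = μ r • A r)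
    (hμ : ∀ r, μ (r + M) = μ r)
    (hμ' : ∀ r : ℤ, Function.Injective fun i : Fin M => μ (r + (i : ℕ)))
    (r : ℤ) (n n' : Fin M) : A (r + M) n * A r n' = A r n * A (r + M) n' := by
  obtain ⟨c, hc0, hc⟩ := exists_ne_zero_mulVec_eq_zero (R := R) (ρ := Fin M)
    (κ := Option (Fin M)) (by simp)
    (Matrix.of fun k o => Option.elim o (A (r + M) k) fun i => A (r + (i : ℕ)) k)
  have hrel : ∀ k, c none * A (r + M) k + ∑ i : Fin M, c (some i) * A (r + (i : ℕ)) k = 0 := by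
    intro k
    have := congrFun hc k
    simpa [Matrix.mulVec, dotProduct, Fintype.sum_option, mul_comm] using this
  have hev : ∀ (s : ℤ) (u : Fin M → R), u ≠ 0 → Matrix.vecMul u X = μ s • u →
      Module.End.HasEigenvector (R := R) (M := Fin M → R) X.vecMulLinear (μ s) u :=
    fun s u h0 h => ⟨Module.End.mem_eigenspace_iff.2 h, h0⟩
  -- The two vectors sharing the eigenvalue `μ r` are merged. If `v` were nonzero it would be an
  -- eigenvector, and the relation would contradict the independence of eigenvectors with distinct
  -- eigenvalues.
  set v : Fin M → R := c none • A (r + M) + c (some 0) • A r with hv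
  have hsum : ∀ g : Fin M → Fin M → R, (∀ i, i ≠ 0 → g i = c (some i) • A (r + (i : ℕ))) →
      ∑ i, g i = g 0 - v := by
    intro g hg
    have h1 : ∑ i, g i = g 0 + ∑ i ∈ Finset.univ.erase 0, c (some i) • A (r + (i : ℕ)) := by
      rw [← Finset.add_sum_erase _ _ (Finset.mem_univ 0)]
      congr 1
      exact Finset.sum_congr rfl fun i hi => hg i (Finset.ne_of_mem_erase hi)
    have h2 : c none • A (r + M) + ∑ i : Fin M, c (some i) • A (r + (i : ℕ)) = 0 := by
      ext k
      simpa [Finset.sum_apply] using hrel k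
    rw [← Finset.add_sum_erase _ _ (Finset.mem_univ 0)] at h2
    rw [h1, hv, eq_sub_iff_add_eq, add_assoc, add_eq_left, ← h2]
    simp only [Fin.val_zero, Nat.cast_zero, add_zero]
    abel
  have hv0 : v = 0 := by
    by_contra hne
    have hvX : Matrix.vecMul v X = μ r • v := by
      simp only [hv, Matrix.add_vecMul, Matrix.smul_vecMul, hX, hμ, smul_add]
      rw [smul_comm, smul_comm (μ r) (c (some 0))]
    have hli := Module.End.eigenvectors_linearIndependent' (R := R) (M := Fin M → R)
      X.vecMulLinear (fun i : Fin M => μ (r + (i : ℕ))) (hμ' r)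
      (fun i => if i = 0 then v else A (r + (i : ℕ))) (by
        intro i
        by_cases hi : i = 0
        · subst hi
          simpa using hev r v hne hvX
        · simpa [hi] using hev _ _ (hA _) (hX _))
    have := Fintype.linearIndependent_iff.1 hli (fun i => if i = 0 then 1 else c (some i))
      (by rw [hsum _ (fun i hi => by simp [hi])]; simp) 0
    simp at this
  have hci : ∀ i, i ≠ 0 → c (some i) = 0 := by
    have hli := Module.End.eigenvectors_linearIndependent' (R := R) (M := Fin M → R)
      X.vecMulLinear (fun i : Fin M => μ (r + (i : ℕ))) (hμ' r)
      (fun i => A (r + (i : ℕ))) (fun i => hev _ _ (hA _) (hX _))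
    intro i hi
    have := Fintype.linearIndependent_iff.1 hli (fun i => if i = 0 then 0 else c (some i))
      (by rw [hsum _ (fun i hi => by simp [hi])]; simp [hv0]) i
    simpa [hi] using this
  have hcn : c none ≠ 0 := by
    intro h
    have h0 : c (some 0) = 0 := by
      simpa [hv, h, hA r] using hv0
    refine hc0 (funext fun o => ?_)
    rcases o with _ | i
    · exact h
    · by_cases hi : i = 0
      · rw [hi]; exact h0
      · exact hci i hi
  have e : ∀ k, c none * A (r + M) k + c (some 0) * A r k = 0 := fun k => by
    simpa [hv] using congrFun hv0 k
  refine mul_left_cancel₀ hcn ?_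
  linear_combination A r n' * e n - A r n * e n'

/-! ### Ghosts: real sources with zero data -/

open ComplexConjugate

/-- Sources are real, so a prescribed spectrum can only be realized together with its Hermitian
mirror image. -/
theorem spectrum_re_fourierInv (H : 𝓢(Plane, ℂ)) (p : Plane) :
    spectrum ((𝓕⁻ H).postcompCLM Complex.reCLM) p = (H p + conj (H (-p))) / 2 := by
  set g : 𝓢(Plane, ℂ) := 𝓕⁻ H with hg
  have hH : ∀ q, 𝓕 (g : Plane → ℂ) q = H q := by
    intro q
    rw [← SchwartzMap.fourier_coe, hg, FourierTransform.fourier_fourierInv_eq]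
  have hint : Integrable (fun v => g v) := g.integrable
  have h1 : Integrable fun v => 𝐞 (-(inner ℝ v p)) • g v :=
    (Real.fourierIntegral_convergent_iff p).2 hint
  have hint' : Integrable (fun v => conj (g v)) :=
    (Complex.conjLIE.toContinuousLinearEquiv.integrable_comp_iff).2 hint
  have h2 : Integrable fun v => 𝐞 (-(inner ℝ v p)) • conj (g v) :=
    (Real.fourierIntegral_convergent_iff p).2 hint'
  have e1 : ∫ v, 𝐞 (-(inner ℝ v p)) • g v = H p := by
    rw [← hH p, Real.fourier_eq]
  have e2 : ∫ v, 𝐞 (-(inner ℝ v p)) • conj (g v) = conj (H (-p)) := by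
    rw [← hH (-p), Real.fourier_eq, ← integral_conj]
    congr 1
    ext v
    simp [Circle.smul_def, ← Circle.coe_inv_eq_conj, AddChar.map_neg_eq_inv]
  rw [spectrum, Real.fourier_eq, ← e1, ← e2, ← integral_add h1 h2, ← integral_div]
  congr 1
  ext v
  have : ((g v).re : ℂ) = (g v + conj (g v)) / 2 := by
    rw [Complex.add_conj]; push_cast; ring
  simp only [SchwartzMap.postcompCLM_apply, Complex.reCLM_apply, Circle.smul_def, smul_eq_mul, this]
  ring

section kernel

variable {M : ℕ} {σ : Type*} [Fintype σ]

/-- The amplitude and time shift of a trace as a multiplier in the (complex) frequency. -/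
noncomputable def encoder (a τ : Fin M → ℤ → ℝ) (n : Fin M) (j : ℤ) : entire :=
  ⟨fun z => a n j * Complex.exp (2 * Real.pi * Complex.I * (z * τ n j)),
    ((differentiable_id.mul_const _).const_mul _).cexp.const_mul _⟩

theorem encoder_apply (a τ : Fin M → ℤ → ℝ) (n : Fin M) (j : ℤ) (z : ℂ) :
    (encoder a τ n j : ℂ → ℂ) z = a n j * Complex.exp (2 * Real.pi * Complex.I * (z * τ n j)) :=
  rfl

/-- The root of unity `exp (2 π i l / N)`. -/
noncomputable def phase (N : ℕ) (l : ℤ) : ℂ := Complex.exp (2 * Real.pi * Complex.I * (l / N))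

/-- Spectra `x n i` at the wavenumbers `k + s i / (N Δ)` cancel in the data of every trace. -/
def Cancels (N : ℕ) (a τ : Fin M → ℤ → ℝ) (s : σ → ℤ) (x : Fin M → σ → entire) : Prop :=
  ∀ j : ℤ, ∑ n, ∑ i, encoder a τ n j * algebraMap ℂ entire (phase N (j * s i)) * x n i = 0

/-- The spectrum with profile `G` and multiplier `x i` at the wavenumber shift `q i`. -/
def ghost (x : σ → entire) (q : σ → ℝ) (G : Plane → ℝ) (p : Plane) : ℂ :=
  ∑ i, (x i : ℂ → ℂ) (p 0) * G (p - !₂[0, q i])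

theorem contDiff_ghost_term (x : entire) (q : ℝ) {G : Plane → ℝ} (hG : ContDiff ℝ (⊤ : ℕ∞) G) :
    ContDiff ℝ (⊤ : ℕ∞) fun p : Plane => (x : ℂ → ℂ) (p 0) * (G (p - !₂[0, q]) : ℂ) := by
  have h0 : ContDiff ℝ (⊤ : ℕ∞) fun p : Plane => p 0 := by fun_prop
  have h1 : ContDiff ℝ (⊤ : ℕ∞) fun p : Plane => G (p - !₂[0, q]) := hG.comp (by fun_prop)
  exact ((entire.contDiff_comp_ofReal x).comp h0).mul (Complex.ofRealCLM.contDiff.comp h1)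

theorem hasCompactSupport_ghost_term (x : entire) (q : ℝ) {G : Plane → ℝ}
    (hG : HasCompactSupport G) :
    HasCompactSupport fun p : Plane => (x : ℂ → ℂ) (p 0) * (G (p - !₂[0, q]) : ℂ) := by
  have h1 : HasCompactSupport fun p : Plane => G (p - !₂[0, q]) :=
    hG.comp_homeomorph (Homeomorph.subRight !₂[0, q])
  have h2 : HasCompactSupport fun p : Plane => (G (p - !₂[0, q]) : ℂ) :=
    h1.comp_left (g := fun r : ℝ => (r : ℂ)) Complex.ofReal_zero
  exact h2.mul_left

theorem contDiff_ghost (x : σ → entire) (q : σ → ℝ) {G : Plane → ℝ}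
    (hG : ContDiff ℝ (⊤ : ℕ∞) G) : ContDiff ℝ (⊤ : ℕ∞) (ghost x q G) :=
  ContDiff.sum fun i _ => contDiff_ghost_term (x i) (q i) hG

theorem hasCompactSupport_ghost (x : σ → entire) (q : σ → ℝ) {G : Plane → ℝ}
    (hG : HasCompactSupport G) : HasCompactSupport (ghost x q G) := by
  have : ∀ S : Finset σ, HasCompactSupport fun p : Plane =>
      ∑ i ∈ S, (x i : ℂ → ℂ) (p 0) * (G (p - !₂[0, q i]) : ℂ) := by
    classical
    intro S
    induction S using Finset.induction_on with
    | empty => exact HasCompactSupport.zero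
    | insert i S hi ih =>
      simp only [Finset.sum_insert hi]
      exact (hasCompactSupport_ghost_term (x i) (q i) hG).add ih
  exact this Finset.univ

/-- The source, in time and space, with spectrum `ghost`. -/
noncomputable def ghostSource (x : σ → entire) (q : σ → ℝ) {G : Plane → ℝ}
    (hG : ContDiff ℝ (⊤ : ℕ∞) G) (hG' : HasCompactSupport G) : 𝓢(Plane, ℂ) :=
  𝓕⁻ ((hasCompactSupport_ghost x q hG').toSchwartzMap (contDiff_ghost x q hG))

theorem integrable_ghost_term (x : entire) (q : ℝ) {G : Plane → ℝ}
    (hG : ContDiff ℝ (⊤ : ℕ∞) G) (hG' : HasCompactSupport G) (v : Plane) :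
    Integrable fun p : Plane =>
      Complex.exp (2 * Real.pi * Complex.I * (p 0 * v 0 + (p 1 + q) * v 1)) *
        ((x : ℂ → ℂ) (p 0) * G p) := by
  have hs := hasCompactSupport_ghost_term x 0 hG'
  have hc := (contDiff_ghost_term x 0 hG).continuous
  have hz : (!₂[0, 0] : Plane) = 0 := by ext k; fin_cases k <;> rfl
  simp only [hz, sub_zero] at hs hc
  refine Continuous.integrable_of_hasCompactSupport ?_ hs.mul_left
  refine Continuous.mul ?_ hc
  fun_prop

theorem ghostSource_apply (x : σ → entire) (q : σ → ℝ) {G : Plane → ℝ}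
    (hG : ContDiff ℝ (⊤ : ℕ∞) G) (hG' : HasCompactSupport G) (v : Plane) :
    ghostSource x q hG hG' v = ∑ i, ∫ p : Plane,
      Complex.exp (2 * Real.pi * Complex.I * (p 0 * v 0 + (p 1 + q i) * v 1)) *
        ((x i : ℂ → ℂ) (p 0) * G p) := by
  rw [ghostSource, SchwartzMap.fourierInv_coe, Real.fourierInv_eq']
  have key : ∀ p : Plane, Complex.exp (((2 * Real.pi * inner ℝ p v : ℝ) : ℂ) * Complex.I) •
      ghost x q G p = ∑ i, (fun p' : Plane =>
        Complex.exp (2 * Real.pi * Complex.I * (p' 0 * v 0 + (p' 1 + q i) * v 1)) *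
        ((x i : ℂ → ℂ) (p' 0) * G p')) (p - !₂[0, q i]) := by
    intro p
    simp only [ghost, smul_eq_mul, Finset.mul_sum]
    refine Finset.sum_congr rfl fun i _ => ?_
    simp [PiLp.inner_apply, Fin.sum_univ_two]
    left
    congr 1
    ring
  have : (fun p : Plane => Complex.exp (((2 * Real.pi * inner ℝ p v : ℝ) : ℂ) * Complex.I) •
      ((hasCompactSupport_ghost x q hG').toSchwartzMap (contDiff_ghost x q hG)) p) = _ :=
    funext key
  rw [this, integral_finsetSum _ fun i _ =>
    (integrable_ghost_term (x i) (q i) hG hG' v).comp_sub_right _]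
  exact Finset.sum_congr rfl fun i _ => integral_sub_right_eq_self (fun p : Plane =>
    Complex.exp (2 * Real.pi * Complex.I * (p 0 * v 0 + (p 1 + q i) * v 1)) *
      ((x i : ℂ → ℂ) (p 0) * G p)) _

/-- Since h·Δ·N = 1, a wavenumber shift by `s i * h` acts on the trace at `Δ * j` as `phase N (j * s
i)`. Translating every alias back to the bump turns the data into one integral whose integrand is a
multiple of the cancellation relation. The offset `l` only contributes a common phase. -/
theorem Cancels.recorded_ghostSource {N : ℕ} {a τ : Fin M → ℤ → ℝ} {s : σ → ℤ}
    {x : Fin M → σ → entire} (hx : Cancels N a τ s x) {Δ h : ℝ} (hh : h * Δ * N = 1) (l : ℤ)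
    {G : Plane → ℝ} (hG : ContDiff ℝ (⊤ : ℕ∞) G) (hG' : HasCompactSupport G) (t : ℝ) (j : ℤ) :
    recorded Δ a τ (fun n => (ghostSource (x n) (fun i => (s i - l) * h) hG hG').postcompCLM
      Complex.reCLM) t j = 0 := by
  set q : σ → ℝ := fun i => (s i - l) * h with hq
  have hre : recorded Δ a τ (fun n => (ghostSource (x n) q hG hG').postcompCLM
      Complex.reCLM) t j =
      (∑ n, (a n j : ℂ) * ghostSource (x n) q hG hG' !₂[t + τ n j, Δ * j]).re := by
    simp [recorded]
  rw [hre]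
  simp only [ghostSource_apply, Finset.mul_sum, ← integral_const_mul]
  have hint : ∀ n i, Integrable fun p : Plane => (a n j : ℂ) *
      (Complex.exp (2 * Real.pi * Complex.I * (p 0 * (!₂[t + τ n j, Δ * j] : Plane) 0 +
        (p 1 + q i) * (!₂[t + τ n j, Δ * j] : Plane) 1)) * ((x n i : ℂ → ℂ) (p 0) * G p)) :=
    fun n i => (integrable_ghost_term (x n i) (q i) hG hG' _).const_mul _
  simp only [← integral_finsetSum _ fun i _ => hint _ i]
  rw [← integral_finsetSum _ fun n _ => integrable_finsetSum _ fun i _ => hint n i]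
  rw [integral_eq_zero_of_ae, Complex.zero_re]
  refine Eventually.of_forall fun p => ?_
  have hj := congrArg (entire.eval (p 0)) (hx j)
  simp only [map_sum, map_mul, entire.eval_apply, entire.coe_algebraMap, map_zero,
    encoder_apply, phase] at hj
  have hN : (N : ℂ) ≠ 0 := by
    rintro h0
    have : (N : ℝ) = 0 := by exact_mod_cast h0
    simp [this] at hh
  have hh' : (h : ℂ) * Δ = 1 / N := by
    rw [eq_div_iff hN]
    exact_mod_cast hh
  simp only [Pi.zero_apply]
  rw [← mul_zero (Complex.exp (2 * Real.pi * Complex.I *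
    (p 0 * t + p 1 * (Δ * j) - l * j / N)) * G p), ← hj]
  simp only [Finset.mul_sum]
  refine Finset.sum_congr rfl fun n _ => Finset.sum_congr rfl fun i _ => ?_
  have hexp : Complex.exp (2 * Real.pi * Complex.I * (p 0 * ((t + τ n j : ℝ) : ℂ) +
        (p 1 + (q i : ℝ)) * ((Δ * j : ℝ) : ℂ))) =
      Complex.exp (2 * Real.pi * Complex.I * (p 0 * t + p 1 * (Δ * j) - l * j / N)) *
      Complex.exp (2 * Real.pi * Complex.I * (p 0 * τ n j)) *
      Complex.exp (2 * Real.pi * Complex.I * ((j * s i : ℤ) / N)) := by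
    rw [← Complex.exp_add, ← Complex.exp_add]
    congr 1
    simp only [hq]
    push_cast
    linear_combination (2 * Real.pi * Complex.I * (s i - l) * j) * hh'
  simp only [Matrix.cons_val_zero, Matrix.cons_val_one]
  rw [hexp]
  ring

theorem isOpen_cone (c₀ : ℝ) : IsOpen (cone c₀) :=
  isOpen_lt (by fun_prop) (by fun_prop)

theorem neg_mem_cone {c₀ : ℝ} {p : Plane} (hp : -p ∈ cone c₀) : p ∈ cone c₀ := by
  simpa [cone] using hp

@[simp] theorem spectrum_zero (p : Plane) : spectrum 0 p = 0 := by
  simp [spectrum, Real.fourier_eq]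

theorem admissible_zero (c₀ : ℝ) : Admissible c₀ (0 : Fin M → 𝓢(Plane, ℝ)) := fun n => by
  have : spectrum ((0 : Fin M → 𝓢(Plane, ℝ)) n) = fun _ => 0 := funext fun p => spectrum_zero p
  rw [this, tsupport_fun_zero]
  exact Set.empty_subset _

theorem recorded_zero (Δ : ℝ) (a τ : Fin M → ℤ → ℝ) (t : ℝ) (j : ℤ) :
    recorded Δ a τ 0 t j = 0 := by
  simp [recorded]

/-- Multipliers that cancel in the data vanish at every determined point from which the wavenumber
shifts stay inside the cone. -/
theorem UniquelyDeterminedOn.apply_eq_zero {N : ℕ} {a τ : Fin M → ℤ → ℝ} {Δ c₀ h : ℝ}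
    {E : Set Plane} (hE : UniquelyDeterminedOn Δ c₀ a τ E) (hc₀ : 0 < c₀) (hh0 : 0 < h)
    (hh : h * Δ * N = 1) {s : σ → ℤ} (hs : Function.Injective s) {x : Fin M → σ → entire}
    (hx : Cancels N a τ s x) (i₀ : σ) {p : Plane} (hp : p ∈ E)
    (hcone : ∀ i n, x n i ≠ 0 → !₂[p 0, p 1 + (s i - s i₀) * h] ∈ cone c₀) (n : Fin M) :
    (x n i₀ : ℂ → ℂ) (p 0) = 0 := by
  by_cases hxn : x n i₀ = 0
  · simp [hxn]
  set q : σ → ℝ := fun i => (s i - s i₀) * h with hq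
  have hadd : ∀ (v : Plane) (r : ℝ), v + !₂[0, r] = !₂[v 0, v 1 + r] := fun v r => by
    ext k; fin_cases k <;> simp
  have hp0 : p 0 ≠ 0 := by
    have h0 := hcone i₀ n hxn
    simp only [cone, Set.mem_ofPred_eq, Matrix.cons_val_zero, Matrix.cons_val_one] at h0
    exact abs_pos.1 (lt_of_le_of_lt (by positivity) h0)
  -- A bump supported here has all aliases that are in use inside the cone, no mirror image at `p`
  -- (the sign of the frequency is fixed), and no other alias over `p` (the strip has half-width
  -- `h`).
  let O : Set Plane := (⋂ i ∈ {i | ∃ n, x n i ≠ 0}, {v : Plane | v + !₂[0, q i] ∈ cone c₀}) ∩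
    ({v | 0 < v 0 * p 0} ∩ {v | |v 1 - p 1| < h})
  have hO : IsOpen O := by
    refine IsOpen.inter (Set.Finite.isOpen_biInter (Set.toFinite _) fun i _ =>
      (isOpen_cone c₀).preimage (by fun_prop)) (IsOpen.inter ?_ ?_)
    · exact isOpen_lt (by fun_prop) (by fun_prop)
    · exact isOpen_lt (by fun_prop) (by fun_prop)
  have hpO : p ∈ O := by
    refine ⟨Set.mem_iInter₂.2 fun i hi => ?_, ?_, ?_⟩
    · obtain ⟨n', hn'⟩ := hi
      rw [Set.mem_ofPred_eq, hadd]
      exact hcone i n' hn'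
    · exact mul_self_pos.2 hp0
    · simpa using hh0
  obtain ⟨G, hGO, hGc, hG, -, hGp⟩ :=
    exists_contDiff_tsupport_subset (n := (⊤ : ℕ∞)) (hO.mem_nhds hpO)
  have hGO' : ∀ v, G v ≠ 0 → v ∈ O := fun v hv => hGO (subset_tsupport G hv)
  have hspec : ∀ n' v, spectrum ((ghostSource (x n') q hG hGc).postcompCLM Complex.reCLM) v =
      (ghost (x n') q G v + conj (ghost (x n') q G (-v))) / 2 :=
    fun n' v => spectrum_re_fourierInv _ v
  have hadm : Admissible c₀ fun n' => (ghostSource (x n') q hG hGc).postcompCLM Complex.reCLM := by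
    intro n'
    let T : Set Plane := ⋃ i ∈ {i | x n' i ≠ 0}, {v : Plane | v - !₂[0, q i] ∈ tsupport G}
    have hT : IsClosed T := Set.Finite.isClosed_biUnion (Set.toFinite _) fun i _ =>
      (isClosed_tsupport G).preimage (by fun_prop)
    have hTc : T ⊆ cone c₀ := by
      intro v hv
      obtain ⟨i, hi, hv⟩ := Set.mem_iUnion₂.1 hv
      have := Set.mem_iInter₂.1 (hGO hv).1 i ⟨n', hi⟩
      simpa using this
    have hgT : ∀ v, ghost (x n') q G v ≠ 0 → v ∈ T := by
      intro v hv
      obtain ⟨i, -, hi⟩ := Finset.exists_ne_zero_of_sum_ne_zero hv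
      refine Set.mem_iUnion₂.2 ⟨i, ?_, ?_⟩
      · rintro h0
        simp [h0] at hi
      · refine subset_tsupport G ?_
        intro h0
        simp [h0] at hi
    refine (closure_minimal (t := T ∪ Neg.neg ⁻¹' T) ?_
      (hT.union (hT.preimage continuous_neg))).trans ?_
    · intro v hv
      by_contra hvT
      simp only [Set.mem_union, Set.mem_preimage, not_or] at hvT
      have h1 : ghost (x n') q G v = 0 := by_contra fun h => hvT.1 (hgT v h)
      have h2 : ghost (x n') q G (-v) = 0 := by_contra fun h => hvT.2 (hgT _ h)
      exact hv (by rw [hspec, h1, h2]; simp)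
    · rintro v (hv | hv)
      · exact hTc hv
      · exact neg_mem_cone (hTc hv)
  have h0 := hE _ 0 hadm (admissible_zero c₀)
    (fun t j => (hx.recorded_ghostSource hh (s i₀) hG hGc t j).trans
      (recorded_zero Δ a τ t j).symm) n p hp
  rw [hspec] at h0
  have h1 : ghost (x n) q G p = (x n i₀ : ℂ → ℂ) (p 0) := by
    rw [ghost, Finset.sum_eq_single i₀]
    · have hz : (!₂[0, q i₀] : Plane) = 0 := by ext k; fin_cases k <;> simp [hq]
      simp [hz, hGp]
    · intro i _ hi
      suffices G (p - !₂[0, q i]) = 0 by simp [this]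
      by_contra hne
      have := (hGO' _ hne).2.2
      simp only [hq, Set.mem_ofPred_eq, PiLp.sub_apply, Matrix.cons_val_one,
        Matrix.cons_val_fin_one, sub_sub_cancel_left,
        abs_neg, abs_mul, abs_of_pos hh0] at this
      have h2 : |((s i - s i₀ : ℤ) : ℝ)| < 1 := by
        push_cast
        nlinarith
      have h3 : |s i - s i₀| < 1 := by exact_mod_cast h2
      exact hi (hs (sub_eq_zero.1 (Int.abs_lt_one_iff.1 h3)))
    · simp
  have h2 : ghost (x n) q G (-p) = 0 := by
    refine Finset.sum_eq_zero fun i _ => ?_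
    suffices G (-p - !₂[0, q i]) = 0 by simp [this]
    by_contra hne
    have := (hGO' _ hne).2.1
    simp only [Set.mem_ofPred_eq, PiLp.sub_apply, PiLp.neg_apply, Matrix.cons_val_zero,
      sub_zero] at this
    nlinarith [mul_self_nonneg (p 0)]
  have h3 : spectrum ((0 : Fin M → 𝓢(Plane, ℝ)) n) p = 0 := spectrum_zero p
  rw [h1, h2, h3] at h0
  simpa using h0

end kernel

/-! ### Geometry of the cone and the diamond -/

section geometry

variable {M : ℕ} {Δ c₀ : ℝ}

/-- Inside the cone only the removed cone on the side of `p 1` matters, and its far flank is out of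
reach because `c₀ * |p 1| < |p 0|`. -/
theorem mem_diamond_iff [NeZero M] (hΔ : 0 < Δ) (hc₀ : 0 < c₀) {p : Plane} :
    p ∈ diamond M Δ c₀ ↔ c₀ * |p 1| < |p 0| ∧ |p 0| + c₀ * |p 1| < c₀ * (1 / (M * Δ)) := by
  have hM : (0 : ℝ) < M := Nat.cast_pos.2 (NeZero.pos M)
  have hB : 0 < 1 / (M * Δ) := by positivity
  set B := 1 / (M * Δ)
  have e : ∀ r : ℝ, c₀ * |r| = |c₀ * r| := fun r => by rw [abs_mul, abs_of_pos hc₀]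
  have hb : 0 < c₀ * B := by positivity
  simp only [diamond, cone, Set.mem_sdiff, Set.mem_ofPred_eq, not_or, not_le, e, mul_add, mul_sub]
  generalize c₀ * p 1 = k at *
  generalize c₀ * B = b at *
  constructor
  · rintro ⟨h1, h2, h3⟩
    refine ⟨h1, ?_⟩
    rcases abs_cases k with ⟨hk, _⟩ | ⟨hk, _⟩ <;> rcases abs_cases (k + b) with ⟨h4, _⟩ | ⟨h4, _⟩ <;>
    rcases abs_cases (k - b) with ⟨h5, _⟩ | ⟨h5, _⟩ <;> linarith
  · rintro ⟨h1, h2⟩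
    refine ⟨h1, ?_, ?_⟩
    · linarith [neg_abs_le k, le_abs_self (k + b)]
    · linarith [le_abs_self k, neg_abs_le (k - b)]

/-- The hypothesis says that the distance from `p 1` to the opposite edge of the cone, at the same
frequency, exceeds `B`; moves toward that edge by at most `B` are therefore harmless. -/
theorem shift_mem_cone (hc₀ : 0 < c₀) {B : ℝ} {p : Plane} (hp : p ∈ cone c₀)
    (h : c₀ * B < |p 0| + c₀ * |p 1|) {δ : ℝ}
    (hδ : p 1 ≤ 0 ∧ 0 ≤ δ ∧ δ ≤ B ∨ 0 ≤ p 1 ∧ -B ≤ δ ∧ δ ≤ 0) :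
    !₂[p 0, p 1 + δ] ∈ cone c₀ := by
  simp only [cone, Set.mem_ofPred_eq, Matrix.cons_val_zero, Matrix.cons_val_one,
    Matrix.cons_val_fin_one] at hp ⊢
  rcases hδ with ⟨h1, h2, h3⟩ | ⟨h1, h2, h3⟩
  · rw [abs_of_nonpos h1] at hp h
    rcases abs_cases (p 1 + δ) with ⟨h4, _⟩ | ⟨h4, _⟩ <;> rw [h4] <;> nlinarith
  · rw [abs_of_nonneg h1] at hp h
    rcases abs_cases (p 1 + δ) with ⟨h4, _⟩ | ⟨h4, _⟩ <;> rw [h4] <;> nlinarith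

end geometry

/-! ### Roots of unity -/

section phase

theorem phase_add (N : ℕ) (l l' : ℤ) : phase N (l + l') = phase N l * phase N l' := by
  rw [phase, phase, phase, ← Complex.exp_add]
  push_cast
  ring_nf

theorem phase_eq_zpow (N : ℕ) (l : ℤ) :
    phase N l = Complex.exp (2 * Real.pi * Complex.I / N) ^ l := by
  rw [phase, ← Complex.exp_int_mul]
  ring_nf

theorem phase_eq_one_iff {N : ℕ} (hN : N ≠ 0) (l : ℤ) : phase N l = 1 ↔ (N : ℤ) ∣ l := by
  rw [phase_eq_zpow]
  exact (Complex.isPrimitiveRoot_exp N hN).zpow_eq_one_iff_dvd l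

theorem phase_eq_phase_iff {N : ℕ} (hN : N ≠ 0) (l l' : ℤ) :
    phase N l = phase N l' ↔ (N : ℤ) ∣ l - l' := by
  rw [← phase_eq_one_iff hN, sub_eq_add_neg, phase_add]
  have : phase N l' * phase N (-l') = 1 := by
    rw [← phase_add, add_neg_cancel, phase_eq_one_iff hN]
    exact dvd_zero _
  constructor
  · intro h; rw [h, this]
  · intro h
    calc phase N l = phase N l * phase N (-l') * phase N l' := by
          rw [mul_assoc, mul_comm (phase N (-l')), this, mul_one]
      _ = _ := by rw [h, one_mul]

theorem phase_mul_mul {d : ℕ} (hd : d ≠ 0) (N : ℕ) (l : ℤ) :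
    phase (N * d) (l * d) = phase N l := by
  rw [phase, phase]
  congr 2
  push_cast
  rw [mul_div_mul_right]
  exact_mod_cast hd

theorem phase_nat_mul (N k : ℕ) (l : ℤ) : phase N (k * l) = phase N l ^ k := by
  rw [phase_eq_zpow, phase_eq_zpow, ← zpow_natCast, ← zpow_mul, mul_comm l]

end phase

/-! ### Solving the cancellation equations -/

section algebra

variable {M N : ℕ} {σ : Type*} [Fintype σ] {a τ : Fin M → ℤ → ℝ}

theorem encoder_periodic (ha : ∀ n j, a n (j + N) = a n j) (hτ : ∀ n j, τ n (j + N) = τ n j)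
    (n : Fin M) : Function.Periodic (encoder a τ n) (N : ℤ) := fun j => by
  ext z
  rw [encoder_apply, encoder_apply, ha, hτ]

theorem encoder_emod (hper : ∀ n, Function.Periodic (encoder a τ n) (N : ℤ)) (n : Fin M) (j : ℤ) :
    encoder a τ n (j % N) = encoder a τ n j := by
  conv_rhs => rw [← Int.emod_add_mul_ediv j N, mul_comm]
  exact ((hper n).int_mul (j / N) (j % N)).symm

theorem cancels_of_forall_fin (hN : N ≠ 0)
    (hper : ∀ n, Function.Periodic (encoder a τ n) (N : ℤ)) {s : σ → ℤ} {x : Fin M → σ → entire}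
    (h : ∀ r : Fin N, ∑ n, ∑ i, encoder a τ n (r : ℕ) *
      algebraMap ℂ entire (phase N ((r : ℕ) * s i)) * x n i = 0) : Cancels N a τ s x := by
  intro j
  have hN' : (0 : ℤ) < N := by exact_mod_cast Nat.pos_of_ne_zero hN
  have h0 := Int.emod_nonneg j hN'.ne'
  have h1 := Int.emod_lt_of_pos j hN'
  have := h ⟨(j % N).toNat, by omega⟩
  simp only [Int.toNat_of_nonneg h0, encoder_emod hper] at this
  rw [← this]
  refine Finset.sum_congr rfl fun n _ => Finset.sum_congr rfl fun i _ => ?_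
  congr 3
  rw [phase_eq_phase_iff hN, ← sub_mul]
  exact (Int.dvd_self_sub_emod).mul_right _

/-- The injection `c` selects which unknowns, pairs of a source and an alias, may be nonzero; only
these are counted against the equations. -/
theorem exists_ne_zero_forall_row {ρ κ : Type*} [Fintype ρ] [Fintype κ]
    (hc : Fintype.card ρ < Fintype.card κ)
    (r : ρ → ℤ) {c : κ → Fin M × σ} (hinj : Function.Injective c) (s : σ → ℤ) :
    ∃ x : Fin M → σ → entire, x ≠ 0 ∧ (∀ n i, (n, i) ∉ Set.range c → x n i = 0) ∧
      ∀ j, ∑ n, ∑ i, encoder a τ n (r j) * algebraMap ℂ entire (phase N (r j * s i)) * x n i = 0 := by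
  obtain ⟨y, hy, hy'⟩ := exists_ne_zero_mulVec_eq_zero (R := entire) hc (Matrix.of fun j k =>
    encoder a τ (c k).1 (r j) * algebraMap ℂ entire (phase N (r j * s (c k).2)))
  refine ⟨fun n i => Function.extend c y 0 (n, i), ?_, ?_, ?_⟩
  · intro h
    refine hy (funext fun k => ?_)
    have := congrFun (congrFun h (c k).1) (c k).2
    simpa [hinj.extend_apply] using this
  · intro n i h
    exact Function.extend_apply' _ _ _ h
  · intro j
    rw [← Fintype.sum_prod_type' (f := fun n i => encoder a τ n (r j) *
      algebraMap ℂ entire (phase N (r j * s i)) * Function.extend c y 0 (n, i)),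
      ← Fintype.sum_of_injective c hinj _ _ ?_ ?_]
    · exact congrFun hy' j
    · intro ni h
      rw [Function.extend_apply' _ _ _ h]
      simp
    · intro k
      simp [hinj.extend_apply]

end algebra

/-! ### Consequences of determination on the diamond -/

section determined

variable {M m : ℕ} [NeZero M] {Δ c₀ : ℝ} {a τ : Fin M → ℤ → ℝ}

/-- The aliases of an encoding of period `N = M (2 m)` are `1 / (N Δ)` apart in wavenumber. -/
theorem spacing_mul (hm : 0 < m) (hΔ : 0 < Δ) :
    1 / ((M * (2 * m) : ℕ) * Δ) * Δ * (M * (2 * m) : ℕ) = 1 := by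
  have hM : (0 : ℝ) < M := Nat.cast_pos.2 (NeZero.pos M)
  have hm' : (0 : ℝ) < m := Nat.cast_pos.2 hm
  push_cast
  field_simp

theorem spacing_pos (hm : 0 < m) (hΔ : 0 < Δ) : 0 < 1 / ((M * (2 * m) : ℕ) * Δ) := by
  have hM : (0 : ℝ) < M := Nat.cast_pos.2 (NeZero.pos M)
  have hm' : (0 : ℝ) < m := Nat.cast_pos.2 hm
  push_cast
  positivity

theorem two_mul_spacing (hm : 0 < m) (hΔ : 0 < Δ) :
    1 / (M * Δ) = 2 * m * (1 / ((M * (2 * m) : ℕ) * Δ)) := by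
  have hM : (0 : ℝ) < M := Nat.cast_pos.2 (NeZero.pos M)
  have hm' : (0 : ℝ) < m := Nat.cast_pos.2 hm
  push_cast
  field_simp

/-- At frequencies just below the widest level c₀/(2MΔ) of the diamond, 2m aliases placed
symmetrically about wavenumber 0 all lie in the diamond, so every multiplier vanishes on an
interval. -/
theorem eq_zero_of_cancels (hm : 0 < m) (hΔ : 0 < Δ) (hc₀ : 0 < c₀)
    (hD : UniquelyDeterminedOn Δ c₀ a τ (diamond M Δ c₀)) {x : Fin M → Fin (2 * m) → entire}
    (hx : Cancels (M * (2 * m)) a τ (fun i : Fin (2 * m) => ((i : ℕ) : ℤ)) x) (n : Fin M)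
    (i : Fin (2 * m)) :
    x n i = 0 := by
  set h := 1 / ((M * (2 * m) : ℕ) * Δ) with hh
  have hpos : 0 < h := spacing_pos hm hΔ
  have hB : 1 / (M * Δ) = 2 * m * h := two_mul_spacing hm hΔ
  have habs : ∀ i : Fin (2 * m), |((i : ℕ) - (2 * m - 1) / 2 : ℝ) * h| ≤ (2 * m - 1) / 2 * h := by
    intro i
    have h1 : ((i : ℕ) : ℝ) + 1 ≤ 2 * m := by exact_mod_cast i.2
    have h2 : (0 : ℝ) ≤ (i : ℕ) := Nat.cast_nonneg _
    rw [abs_mul, abs_of_pos hpos]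
    refine mul_le_mul_of_nonneg_right (abs_le.2 ⟨?_, ?_⟩) hpos.le <;> linarith
  refine entire.eq_zero_of_forall_Ioo (α := c₀ * (m * h - h / 2)) (β := c₀ * (m * h))
    (by nlinarith) fun ω hω hω' => ?_
  have hm1 : (1 : ℝ) ≤ m := by exact_mod_cast hm
  have hω0 : 0 < ω := lt_of_le_of_lt (by
    have : 0 ≤ m * h - h / 2 := by nlinarith
    positivity) hω
  have hlt : ∀ k : ℝ, |k| ≤ (2 * m - 1) / 2 * h → c₀ * |k| < ω := fun k hk =>
    lt_of_le_of_lt (mul_le_mul_of_nonneg_left hk hc₀.le) (by nlinarith)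
  refine hD.apply_eq_zero (p := !₂[ω, ((i : ℕ) - (2 * m - 1) / 2) * h]) hc₀ hpos
    (spacing_mul hm hΔ) (fun i j hij => Fin.ext (by simpa using hij)) hx i ?_ ?_ n
  · rw [mem_diamond_iff hΔ hc₀, hB]
    simp only [Matrix.cons_val_zero, Matrix.cons_val_one, Matrix.cons_val_fin_one, abs_of_pos hω0]
    refine ⟨hlt _ (habs i), ?_⟩
    nlinarith [hlt _ (habs i)]
  · intro i' n' _
    simp only [cone, Set.mem_ofPred_eq, Matrix.cons_val_zero, Matrix.cons_val_one,
      Matrix.cons_val_fin_one, abs_of_pos hω0, Int.cast_natCast]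
    refine hlt _ (le_of_eq_of_le ?_ (habs i'))
    congr 1
    ring

/-- Just above the widest level, 2m + 1 symmetric aliases lie in the cone, and all but the two
outermost in the diamond. -/
theorem interior_eq_zero_of_cancels (hm : 0 < m) (hΔ : 0 < Δ) (hc₀ : 0 < c₀)
    (hD : UniquelyDeterminedOn Δ c₀ a τ (diamond M Δ c₀)) {x : Fin M → Fin (2 * m + 1) → entire}
    (hx : Cancels (M * (2 * m)) a τ (fun i : Fin (2 * m + 1) => ((i : ℕ) : ℤ)) x) (n : Fin M)
    (i : Fin (2 * m + 1)) (hi : i ≠ 0) (hi' : i ≠ Fin.last _) : x n i = 0 := by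
  set h := 1 / ((M * (2 * m) : ℕ) * Δ) with hh
  have hpos : 0 < h := spacing_pos hm hΔ
  have hB : 1 / (M * Δ) = 2 * m * h := two_mul_spacing hm hΔ
  have habs : ∀ i : Fin (2 * m + 1), |((i : ℕ) - m : ℝ) * h| ≤ m * h := by
    intro i
    have h1 : ((i : ℕ) : ℝ) ≤ 2 * m := by exact_mod_cast Nat.lt_succ_iff.1 i.2
    have h2 : (0 : ℝ) ≤ (i : ℕ) := Nat.cast_nonneg _
    rw [abs_mul, abs_of_pos hpos]
    refine mul_le_mul_of_nonneg_right (abs_le.2 ⟨?_, ?_⟩) hpos.le <;> linarith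
  have habs' : |((i : ℕ) - m : ℝ) * h| ≤ (m - 1) * h := by
    have h1 : ((i : ℕ) : ℝ) + 1 ≤ 2 * m := by
      have : (i : ℕ) ≠ 2 * m := fun h => hi' (Fin.ext h)
      have := i.2
      exact_mod_cast (by omega : (i : ℕ) + 1 ≤ 2 * m)
    have h2 : (1 : ℝ) ≤ (i : ℕ) := by
      exact_mod_cast Nat.pos_of_ne_zero fun h => hi (Fin.ext h)
    rw [abs_mul, abs_of_pos hpos]
    refine mul_le_mul_of_nonneg_right (abs_le.2 ⟨?_, ?_⟩) hpos.le <;> linarith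
  refine entire.eq_zero_of_forall_Ioo (α := c₀ * (m * h)) (β := c₀ * (m * h + h))
    (by nlinarith) fun ω hω hω' => ?_
  have hω0 : 0 < ω := lt_of_le_of_lt (by positivity) hω
  have hlt : ∀ i : Fin (2 * m + 1), c₀ * |((i : ℕ) - m : ℝ) * h| < ω := fun i =>
    lt_of_le_of_lt (mul_le_mul_of_nonneg_left (habs i) hc₀.le) hω
  refine hD.apply_eq_zero (p := !₂[ω, ((i : ℕ) - m) * h]) hc₀ hpos
    (spacing_mul hm hΔ) (fun i j hij => Fin.ext (by simpa using hij)) hx i ?_ ?_ n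
  · rw [mem_diamond_iff hΔ hc₀, hB]
    simp only [Matrix.cons_val_zero, Matrix.cons_val_one, Matrix.cons_val_fin_one, abs_of_pos hω0]
    refine ⟨hlt i, ?_⟩
    nlinarith [mul_le_mul_of_nonneg_left habs' hc₀.le]
  · intro i' n' _
    simp only [cone, Set.mem_ofPred_eq, Matrix.cons_val_zero, Matrix.cons_val_one,
      Matrix.cons_val_fin_one, abs_of_pos hω0, Int.cast_natCast]
    refine lt_of_eq_of_lt ?_ (hlt i')
    congr 2
    ring

theorem eq_zero_of_forall_encoder_sum (hm : 0 < m) (hΔ : 0 < Δ) (hc₀ : 0 < c₀)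
    (hD : UniquelyDeterminedOn Δ c₀ a τ (diamond M Δ c₀)) {v : Fin M → entire}
    (hv : ∀ j, ∑ n, encoder a τ n j * v n = 0) (n : Fin M) : v n = 0 := by
  have : NeZero (2 * m) := ⟨by omega⟩
  have := eq_zero_of_cancels hm hΔ hc₀ hD (x := fun n i => if i = 0 then v n else 0) (by
    intro j
    refine (Finset.sum_congr rfl fun n _ => ?_).trans (hv j)
    rw [Finset.sum_eq_single 0]
    · simp [phase]
    · intro i _ hi
      simp [hi]
    · simp) n 0
  simpa using this

/-- A vanishing row would leave N - 1 equations for the N unknowns of 2m aliases, hence a nonzero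
solution. -/
theorem encoder_row_ne_zero (hm : 0 < m) (hΔ : 0 < Δ) (hc₀ : 0 < c₀)
    (hD : UniquelyDeterminedOn Δ c₀ a τ (diamond M Δ c₀))
    (hper : ∀ n, Function.Periodic (encoder a τ n) ((M * (2 * m) : ℕ) : ℤ)) (j : ℤ) :
    (fun n => encoder a τ n j) ≠ 0 := by
  intro h0
  set N := M * (2 * m) with hNdef
  have hN : N ≠ 0 := Nat.mul_ne_zero (NeZero.ne M) (by omega)
  have hN' : (0 : ℤ) < N := by exact_mod_cast Nat.pos_of_ne_zero hN
  have hj0 := Int.emod_nonneg j hN'.ne'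
  have hj1 := Int.emod_lt_of_pos j hN'
  obtain ⟨x, hx0, -, hx⟩ := exists_ne_zero_forall_row (a := a) (τ := τ) (N := N) (σ := Fin (2 * m))
    (ρ := {r : Fin N // r ≠ ⟨(j % N).toNat, by omega⟩}) (κ := Fin M × Fin (2 * m))
    (by
      rw [Fintype.card_subtype_compl]
      simp only [Fintype.card_fin, Fintype.card_unique, Fintype.card_prod]
      omega)
    (fun r => ((r.1 : ℕ) : ℤ)) (c := id) Function.injective_id (fun i => ((i : ℕ) : ℤ))
  refine hx0 (funext fun n => funext fun i => eq_zero_of_cancels hm hΔ hc₀ hD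
    (cancels_of_forall_fin hN hper fun r => ?_) n i)
  by_cases hr : r = ⟨(j % N).toNat, by omega⟩
  · refine Finset.sum_eq_zero fun n _ => Finset.sum_eq_zero fun i _ => ?_
    have : encoder a τ n ((r : ℕ) : ℤ) = 0 := by
      rw [hr]
      simp only [Int.toNat_of_nonneg hj0, encoder_emod hper]
      exact congrFun h0 n
    rw [this, zero_mul, zero_mul]
  · exact hx ⟨r, hr⟩

/-- One unknown more than equations: 2m aliases of every source and the last alias of source `n'`
alone. The interior aliases drop out, and the two ends are 2m steps apart, which turns the N-th root
of unity into an M-th one. -/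
theorem exists_cancels_at_ends (hm : 0 < m) (hΔ : 0 < Δ) (hc₀ : 0 < c₀)
    (hD : UniquelyDeterminedOn Δ c₀ a τ (diamond M Δ c₀))
    (hper : ∀ n, Function.Periodic (encoder a τ n) ((M * (2 * m) : ℕ) : ℤ)) (n' : Fin M) :
    ∃ (x : Fin M → entire) (y : entire), y ≠ 0 ∧ ∀ j : ℤ,
      ∑ n, encoder a τ n j * x n = encoder a τ n' j * algebraMap ℂ entire (phase M j) * y := by
  have hN : M * (2 * m) ≠ 0 := Nat.mul_ne_zero (NeZero.ne M) (by omega)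
  obtain ⟨x, hx0, hxr, hx⟩ := exists_ne_zero_forall_row (a := a) (τ := τ) (N := M * (2 * m))
    (σ := Fin (2 * m + 1)) (ρ := Fin (M * (2 * m))) (κ := Option (Fin M × Fin (2 * m)))
    (by simp) (fun r => ((r : ℕ) : ℤ))
    (c := fun o => o.elim (n', Fin.last _) fun ni => (ni.1, ni.2.castSucc))
    (by
      rintro (_ | ⟨n, i⟩) (_ | ⟨n₁, i₁⟩) h
      · rfl
      · exact absurd (congrArg Prod.snd h).symm (Fin.castSucc_ne_last i₁)
      · exact absurd (congrArg Prod.snd h) (Fin.castSucc_ne_last i)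
      · simpa using h)
    (fun i => ((i : ℕ) : ℤ))
  have hc := cancels_of_forall_fin hN hper hx
  have hlast : ∀ n, n ≠ n' → x n (Fin.last _) = 0 := fun n hn => hxr n _ (by
    rintro ⟨_ | ⟨n₁, i₁⟩, h⟩
    · exact hn (congrArg Prod.fst h).symm
    · exact Fin.castSucc_ne_last i₁ (congrArg Prod.snd h))
  refine ⟨fun n => x n 0, -x n' (Fin.last _), fun hy => hx0 ?_, fun j => ?_⟩
  · have hl : ∀ n, x n (Fin.last _) = 0 := fun n => by
      by_cases hn : n = n'
      · rw [hn]; exact neg_eq_zero.1 hy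
      · exact hlast n hn
    have hs := eq_zero_of_cancels hm hΔ hc₀ hD (x := fun n i => x n i.castSucc) (fun j => by
      have := hc j
      simpa [Fin.sum_univ_castSucc, hl] using this)
    funext n i
    induction i using Fin.lastCases with
    | last => exact hl n
    | cast i => exact hs n i
  · have hint := interior_eq_zero_of_cancels hm hΔ hc₀ hD hc
    have h := hc j
    have hne : (0 : Fin (2 * m + 1)) ≠ Fin.last _ := fun h => by
      have := congrArg Fin.val h
      simp at this
      omega
    have hrow : ∀ n, ∑ i : Fin (2 * m + 1), encoder a τ n j * algebraMap ℂ entire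
        (phase (M * (2 * m)) (j * ((i : ℕ) : ℤ))) * x n i = encoder a τ n j * x n 0 +
        encoder a τ n j * algebraMap ℂ entire (phase M j) * x n (Fin.last _) := by
      intro n
      rw [Fintype.sum_eq_add 0 (Fin.last _) hne fun i hi => by rw [hint n i hi.1 hi.2, mul_zero]]
      congr 2
      · simp [phase]
      · rw [Fin.val_last, phase_mul_mul (by omega)]
    simp only [hrow, Finset.sum_add_distrib] at h
    rw [Finset.sum_eq_single n' (s := Finset.univ) (f := fun n => encoder a τ n j *
      algebraMap ℂ entire (phase M j) * x n (Fin.last _))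
      (fun n _ hn => by rw [hlast n hn, mul_zero]) (by simp)] at h
    linear_combination h

/-- The traces are left eigenvectors of one matrix, with the `M`-th roots of unity, up to a common
factor, as eigenvalues. -/
theorem exists_matrix_encoder (hm : 0 < m) (hΔ : 0 < Δ) (hc₀ : 0 < c₀)
    (hD : UniquelyDeterminedOn Δ c₀ a τ (diamond M Δ c₀))
    (hper : ∀ n, Function.Periodic (encoder a τ n) ((M * (2 * m) : ℕ) : ℤ)) :
    ∃ (X : Matrix (Fin M) (Fin M) entire) (y : entire), y ≠ 0 ∧ ∀ j : ℤ,
      Matrix.vecMul (fun n => encoder a τ n j) X =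
        (y * algebraMap ℂ entire (phase M j)) • fun n => encoder a τ n j := by
  choose x y hy hxy using exists_cancels_at_ends hm hΔ hc₀ hD hper
  -- The factor `y` depends on the column; multiplying each column by the factors of the others
  -- makes the eigenvalue common.
  refine ⟨Matrix.of fun n n' => x n' n * ∏ k ∈ Finset.univ.erase n', y k, ∏ k, y k,
    Finset.prod_ne_zero_iff.2 fun k _ => hy k, fun j => funext fun n' => ?_⟩
  simp only [Matrix.vecMul, dotProduct, Matrix.of_apply, Pi.smul_apply, smul_eq_mul, ← mul_assoc,
    ← Finset.sum_mul, hxy]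
  rw [← Finset.mul_prod_erase _ _ (Finset.mem_univ n')]
  ring

theorem relativelyPeriodicEncoding (hm : 0 < m) (hΔ : 0 < Δ) (hc₀ : 0 < c₀)
    (hD : UniquelyDeterminedOn Δ c₀ a τ (diamond M Δ c₀))
    (hper : ∀ n, Function.Periodic (encoder a τ n) ((M * (2 * m) : ℕ) : ℤ)) :
    RelativelyPeriodicEncoding a τ := by
  obtain ⟨X, y, hy, hX⟩ := exists_matrix_encoder hm hΔ hc₀ hD hper
  have hinj : Function.Injective (algebraMap ℂ entire) := fun c d h => by
    simpa using congrArg (entire.eval 0) h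
  have hM : M ≠ 0 := NeZero.ne M
  have hpar := eigenvectors_parallel X (fun j n => encoder a τ n j)
    (fun j => y * algebraMap ℂ entire (phase M j))
    (encoder_row_ne_zero hm hΔ hc₀ hD hper) hX
    (fun r => by
      have : phase M (r + M) = phase M r := (phase_eq_phase_iff hM _ _).2 (by simp)
      simp only [this])
    (fun r i i' h => by
      have h := hinj (mul_left_cancel₀ hy h)
      rw [phase_eq_phase_iff hM] at h
      have h1 := i.2
      have h2 := i'.2
      have h3 := Int.eq_zero_of_abs_lt_dvd h (abs_lt.2 ⟨by omega, by omega⟩)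
      exact Fin.ext (by omega))
  intro n n' j
  have hev : ∀ ω : ℝ, ((a n (j + M) * a n' j : ℝ) : ℂ) * Complex.exp (2 * Real.pi * Complex.I *
      (ω * (τ n (j + M) + τ n' j))) = ((a n j * a n' (j + M) : ℝ) : ℂ) *
      Complex.exp (2 * Real.pi * Complex.I * (ω * (τ n j + τ n' (j + M)))) := by
    intro ω
    have := congrArg (entire.eval ω) (hpar j n n')
    simp only [map_mul, entire.eval_apply, encoder_apply] at this
    simp only [mul_add, Complex.exp_add] at this ⊢
    push_cast
    linear_combination this
  have ha : a n (j + M) * a n' j = a n j * a n' (j + M) := by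
    have := hev 0
    simp only [Complex.ofReal_zero, zero_mul, mul_zero, Complex.exp_zero, mul_one] at this
    exact_mod_cast this
  refine ⟨ha, fun hne => ?_⟩
  by_contra hτ
  set δ := τ n (j + M) + τ n' j - (τ n j + τ n' (j + M)) with hδ
  have hδ0 : δ ≠ 0 := fun h => hτ (by linarith)
  -- At this frequency the two exponentials differ by the factor exp(πi) = -1.
  have h1 := hev (1 / (2 * δ))
  rw [ha] at h1
  have h2 := mul_left_cancel₀ (Complex.ofReal_ne_zero.2 hne) h1
  have h3 : (2 * Real.pi * Complex.I * (((1 / (2 * δ) : ℝ) : ℂ) * (τ n (j + M) + τ n' j))) =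
      2 * Real.pi * Complex.I * (((1 / (2 * δ) : ℝ) : ℂ) * (τ n j + τ n' (j + M))) +
        Real.pi * Complex.I := by
    have : (δ : ℂ) ≠ 0 := Complex.ofReal_ne_zero.2 hδ0
    have h4 : (τ n (j + M) : ℂ) + τ n' j = (τ n j + τ n' (j + M)) + δ := by
      rw [hδ]; push_cast; ring
    rw [h4]
    push_cast
    field_simp
  rw [h3, Complex.exp_add, Complex.exp_pi_mul_I] at h2
  have := Complex.exp_ne_zero (2 * Real.pi * Complex.I * (((1 / (2 * δ) : ℝ) : ℂ) *
    (τ n j + τ n' (j + M))))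
  apply this
  linear_combination (-1 / 2 : ℂ) * h2

end determined

/-! ### Excluding single points outside the closed diamond -/

/-- A matrix `X` of entire functions and `y ≠ 0` with `X ^ M = y ^ M` have a common factor,
after division by which `X` does not vanish at `c`. -/
theorem exists_saturation {M : ℕ} [NeZero M] {X : Matrix (Fin M) (Fin M) entire} {y : entire}
    (hy : y ≠ 0) (hXy : X ^ M = y ^ M • (1 : Matrix (Fin M) (Fin M) entire)) (c : ℂ) :
    ∃ (d : entire) (X' : Matrix (Fin M) (Fin M) entire) (y' : entire), d ≠ 0 ∧ X = d • X' ∧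
      y = d * y' ∧ ∃ n n', (X' n n' : ℂ → ℂ) c ≠ 0 := by
  classical
  let P : ℕ → Prop := fun e => entire.subConst c ^ e ∣ y ∧ ∀ n n', entire.subConst c ^ e ∣ X n n'
  have hex : ∃ e, ¬ P e := by
    obtain ⟨e, he⟩ := entire.exists_not_subConst_pow_dvd hy c
    exact ⟨e, fun h => he h.1⟩
  obtain ⟨e, he, he'⟩ : ∃ e, P e ∧ ¬ P (e + 1) := by
    by_contra! h
    obtain ⟨e, he⟩ := hex
    refine he ?_
    clear he
    induction e with
    | zero => exact ⟨by simp, by simp⟩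
    | succ e ih => exact h e ih
  obtain ⟨⟨y', hy'⟩, hX⟩ := he
  choose X' hX' using hX
  have hd : entire.subConst c ^ e ≠ 0 := pow_ne_zero _ (entire.subConst_ne_zero c)
  have hXd : X = (entire.subConst c ^ e) • (Matrix.of X') := by
    ext1 n n'
    simp [hX']
  refine ⟨entire.subConst c ^ e, Matrix.of X', y', hd, hXd, hy', ?_⟩
  by_contra! h0
  simp only [Matrix.of_apply] at h0
  by_cases hyc : (y' : ℂ → ℂ) c = 0
  · refine he' ⟨?_, fun n n' => ?_⟩
    · rw [hy', pow_succ]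
      exact mul_dvd_mul_left _ (entire.subConst_dvd_iff.2 hyc)
    · rw [hX', pow_succ]
      exact mul_dvd_mul_left _ (entire.subConst_dvd_iff.2 (h0 n n'))
  -- If `X'` vanished at `c`, then so would `y' ^ M`, and one more factor z - c could be divided
  -- out.
  · have h1 : (Matrix.of X') ^ M = y' ^ M • (1 : Matrix (Fin M) (Fin M) entire) := by
      rw [hXd, hy', smul_pow, mul_pow, mul_smul] at hXy
      exact smul_right_injective _ (pow_ne_zero M hd) hXy
    have h2 := congrArg (entire.eval c).mapMatrix h1
    have h3 : (entire.eval c).mapMatrix (Matrix.of X') = 0 := by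
      ext n n'
      exact h0 n n'
    rw [map_pow, h3, zero_pow (NeZero.ne M)] at h2
    have h4 := congrFun (congrFun h2 0) 0
    simp at h4
    exact hyc ((pow_eq_zero_iff (NeZero.ne M)).1 h4.symm)

section closure

variable {M m : ℕ} {Δ c₀ : ℝ} {a τ : Fin M → ℤ → ℝ}

theorem vecMul_pow_encoder {X : Matrix (Fin M) (Fin M) entire} {y : entire}
    (hX : ∀ j : ℤ, Matrix.vecMul (fun n => encoder a τ n j) X =
        (y * algebraMap ℂ entire (phase M j)) • fun n => encoder a τ n j) (k : ℕ) (j : ℤ) :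
    Matrix.vecMul (fun n => encoder a τ n j) (X ^ k) =
      (y ^ k * algebraMap ℂ entire (phase M (k * j))) • fun n => encoder a τ n j := by
  rw [phase_nat_mul, map_pow, ← mul_pow]
  induction k with
  | zero => simp
  | succ k ih =>
    rw [pow_succ, ← Matrix.vecMul_vecMul, ih, Matrix.smul_vecMul, hX, smul_smul, ← pow_succ]

variable [NeZero M]

/-- Every row annihilates X ^ M - y ^ M, since the eigenvalues are M-th roots of unity times `y`;
the rows have no common kernel. -/
theorem pow_eq_of_vecMul_encoder (hm : 0 < m) (hΔ : 0 < Δ) (hc₀ : 0 < c₀)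
    (hD : UniquelyDeterminedOn Δ c₀ a τ (diamond M Δ c₀))
    {X : Matrix (Fin M) (Fin M) entire} {y : entire}
    (hX : ∀ j : ℤ, Matrix.vecMul (fun n => encoder a τ n j) X =
        (y * algebraMap ℂ entire (phase M j)) • fun n => encoder a τ n j) :
    X ^ M = y ^ M • (1 : Matrix (Fin M) (Fin M) entire) := by
  ext1 n n'
  rw [← sub_eq_zero]
  refine eq_zero_of_forall_encoder_sum (a := a) (τ := τ) hm hΔ hc₀ hD
    (v := fun n => (X ^ M) n n' - (y ^ M • (1 : Matrix (Fin M) (Fin M) entire)) n n')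
    (fun j => ?_) n
  have h := congrFun (vecMul_pow_encoder hX M j) n'
  rw [(phase_eq_one_iff (NeZero.ne M) _).2 (dvd_mul_right _ _), map_one, mul_one] at h
  simp only [Matrix.vecMul, dotProduct, Pi.smul_apply, smul_eq_mul] at h
  simp only [mul_sub, Finset.sum_sub_distrib, h, Matrix.smul_apply, Matrix.one_apply, smul_eq_mul,
    mul_ite, mul_one, mul_zero, Finset.sum_ite_eq', Finset.mem_univ, if_true]
  ring

theorem exists_matrix_encoder_of_sign (hm : 0 < m) (hΔ : 0 < Δ) (hc₀ : 0 < c₀)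
    (hD : UniquelyDeterminedOn Δ c₀ a τ (diamond M Δ c₀))
    (hper : ∀ n, Function.Periodic (encoder a τ n) ((M * (2 * m) : ℕ) : ℤ)) {l : ℤ}
    (hl : l = 1 ∨ l = -1) :
    ∃ (X : Matrix (Fin M) (Fin M) entire) (y : entire), y ≠ 0 ∧
      X ^ M = y ^ M • (1 : Matrix (Fin M) (Fin M) entire) ∧ ∀ j : ℤ,
      Matrix.vecMul (fun n => encoder a τ n j) X =
        (y * algebraMap ℂ entire (phase M (j * l))) • fun n => encoder a τ n j := by
  obtain ⟨X, y, hy, hX⟩ := exists_matrix_encoder hm hΔ hc₀ hD hper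
  have hXy := pow_eq_of_vecMul_encoder hm hΔ hc₀ hD hX
  rcases hl with rfl | rfl
  · exact ⟨X, y, hy, hXy, by simpa using hX⟩
  -- The power M - 1 inverts the root of unity, so that the second alias moves in the opposite
  -- direction.
  · refine ⟨X ^ (M - 1), y ^ (M - 1), pow_ne_zero _ hy, ?_, fun j => ?_⟩
    · rw [← pow_mul, mul_comm, pow_mul, hXy, smul_pow, one_pow, ← pow_mul, ← pow_mul, mul_comm]
    · rw [vecMul_pow_encoder hX]
      have : phase M (((M - 1 : ℕ) : ℤ) * j) = phase M (j * -1) := by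
        rw [phase_eq_phase_iff (NeZero.ne M), Nat.cast_sub (NeZero.one_le)]
        exact ⟨j, by push_cast; ring⟩
      rw [this]

/-- If the spectra are determined on the diamond, then they are not determined at any point of the
cone beyond the closure of the diamond. -/
theorem UniquelyDeterminedOn.abs_add_le (hm : 0 < m) (hΔ : 0 < Δ) (hc₀ : 0 < c₀)
    (hD : UniquelyDeterminedOn Δ c₀ a τ (diamond M Δ c₀))
    (hper : ∀ n, Function.Periodic (encoder a τ n) ((M * (2 * m) : ℕ) : ℤ)) {E : Set Plane}
    (hE : UniquelyDeterminedOn Δ c₀ a τ E) {p : Plane} (hp : p ∈ E) (hpc : p ∈ cone c₀) :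
    |p 0| + c₀ * |p 1| ≤ c₀ * (1 / (M * Δ)) := by
  by_contra! hlt
  have hM : (0 : ℝ) < M := Nat.cast_pos.2 (NeZero.pos M)
  have hB : 0 < 1 / (M * Δ) := by positivity
  obtain ⟨l, hl, hpl⟩ : ∃ l : ℤ, (l = 1 ∨ l = -1) ∧ (l = 1 ∧ p 1 ≤ 0 ∨ l = -1 ∧ 0 ≤ p 1) := by
    rcases le_total (p 1) 0 with h | h
    · exact ⟨1, Or.inl rfl, Or.inl ⟨rfl, h⟩⟩
    · exact ⟨-1, Or.inr rfl, Or.inr ⟨rfl, h⟩⟩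
  obtain ⟨X₀, y₀, hy₀, hXy, hX₀⟩ := exists_matrix_encoder_of_sign hm hΔ hc₀ hD hper hl
  obtain ⟨d, X, y, hd, hXd, hyd, n, n', hne⟩ := exists_saturation hy₀ hXy (p 0)
  have hX : ∀ j : ℤ, Matrix.vecMul (fun n => encoder a τ n j) X =
      (y * algebraMap ℂ entire (phase M (j * l))) • fun n => encoder a τ n j := fun j => by
    have := hX₀ j
    rw [hXd, hyd, Matrix.vecMul_smul, mul_assoc, mul_smul] at this
    exact smul_right_injective _ hd this
  -- Column `n'` of the eigenvector equation is a ghost on two aliases: `X` at `p`, and `-y` of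
  -- source `n'` at distance 1/(MΔ), in the direction `l` across the axis of the cone.
  refine hne (hE.apply_eq_zero (σ := Bool) (N := M * (2 * m)) hc₀ (spacing_pos hm hΔ)
    (spacing_mul hm hΔ) (s := fun b => cond b (l * (2 * m : ℕ)) 0)
    (x := fun n b => cond b (if n = n' then -y else 0) (X n n')) ?_ ?_ false hp ?_ n)
  · have hl0 : l * (2 * m : ℕ) ≠ 0 := mul_ne_zero (by omega) (by exact_mod_cast (by omega))
    rintro (_ | _) (_ | _) h
    · rfl
    · exact absurd h.symm hl0
    · exact absurd h hl0
    · rfl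
  · intro j
    have h := congrFun (hX j) n'
    simp only [Matrix.vecMul, dotProduct, Pi.smul_apply, smul_eq_mul] at h
    have hrow : ∀ n₁, ∑ b : Bool, encoder a τ n₁ j * algebraMap ℂ entire
        (phase (M * (2 * m)) (j * cond b (l * (2 * m : ℕ)) 0)) *
          cond b (if n₁ = n' then -y else 0) (X n₁ n') =
        (if n₁ = n' then encoder a τ n₁ j * algebraMap ℂ entire (phase M (j * l)) * -y else 0) +
          encoder a τ n₁ j * X n₁ n' := by
      intro n₁
      rw [Fintype.sum_bool]
      simp only [cond_true, cond_false, mul_zero]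
      have h1 : phase (M * (2 * m)) 0 = 1 := by simp [phase]
      rw [← mul_assoc j l, phase_mul_mul (show 2 * m ≠ 0 by omega), h1, map_one, mul_one,
        mul_ite, mul_zero]
    rw [Finset.sum_congr rfl fun n₁ _ => hrow n₁, Finset.sum_add_distrib, h, Finset.sum_ite_eq',
      if_pos (Finset.mem_univ _)]
    ring
  · have hB' := two_mul_spacing (M := M) hm hΔ
    rintro (_ | _) n₁ -
    · exact shift_mem_cone hc₀ hpc hlt (by
        rcases hpl with ⟨-, h⟩ | ⟨-, h⟩
        · exact Or.inl ⟨h, by simp, by simpa using hB.le⟩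
        · exact Or.inr ⟨h, by simpa using hB.le, by simp⟩)
    · refine shift_mem_cone hc₀ hpc hlt ?_
      have e : (((l * (2 * m : ℕ) : ℤ) : ℝ) - ((0 : ℤ) : ℝ)) * (1 / ((M * (2 * m) : ℕ) * Δ)) =
          l * (1 / (M * Δ)) := by
        rw [hB']; push_cast; ring
      simp only [cond_true, cond_false, e]
      rcases hpl with ⟨rfl, h⟩ | ⟨rfl, h⟩
      · exact Or.inl ⟨h, by simpa using hB.le, by simp⟩
      · exact Or.inr ⟨h, by simp, by simpa using hB.le⟩

theorem mem_closure_diamond (hΔ : 0 < Δ) (hc₀ : 0 < c₀) {p : Plane} (hpc : p ∈ cone c₀)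
    (hp : |p 0| + c₀ * |p 1| ≤ c₀ * (1 / (M * Δ))) : p ∈ closure (diamond M Δ c₀) := by
  have hM : (0 : ℝ) < M := Nat.cast_pos.2 (NeZero.pos M)
  have hB : 0 < 1 / (M * Δ) := by positivity
  have ht : Tendsto (fun r : ℝ => r • p) (𝓝[<] 1) (𝓝 p) := by
    have : Continuous fun r : ℝ => r • p := by fun_prop
    simpa using (this.tendsto 1).mono_left nhdsWithin_le_nhds
  refine mem_closure_of_tendsto ht ?_
  filter_upwards [Ioo_mem_nhdsLT (show (0 : ℝ) < 1 by norm_num)] with r hr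
  rw [mem_diamond_iff hΔ hc₀]
  simp only [PiLp.smul_apply, smul_eq_mul, abs_mul, abs_of_pos hr.1]
  simp only [cone, Set.mem_ofPred_eq] at hpc
  have h0 : 0 < c₀ * (1 / (M * Δ)) := by positivity
  exact ⟨by nlinarith [hr.1], by nlinarith [hr.1, hr.2]⟩

end closure

/-! ### Measure theory and the area bound -/

section measure

variable {M m : ℕ} {Δ c₀ : ℝ} {a τ : Fin M → ℤ → ℝ}

theorem continuous_spectrum (f : 𝓢(Plane, ℝ)) : Continuous (spectrum f) := by
  have : spectrum f = 𝓕 (f.postcompCLM Complex.ofRealCLM) := rfl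
  rw [this]
  exact (𝓕 (f.postcompCLM Complex.ofRealCLM)).continuous

/-- Unique determination on a set passes to the open sets that it fills up to measure zero. -/
theorem UniquelyDeterminedOn.of_ae_eq {E U : Set Plane} (hE : UniquelyDeterminedOn Δ c₀ a τ E)
    (hU : IsOpen U) (h : E =ᵐ[volume] U) : UniquelyDeterminedOn Δ c₀ a τ U := by
  intro f g hf hg hfg n
  have h0 := hE f g hf hg hfg n
  have hae : spectrum (f n) =ᵐ[volume.restrict U] spectrum (g n) := by
    rw [Filter.EventuallyEq, ae_restrict_iff' hU.measurableSet]
    filter_upwards [h.mem_iff] with p hp hpU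
    exact h0 p (hp.2 hpU)
  exact Measure.eqOn_open_of_ae_eq hae hU (continuous_spectrum _).continuousOn
    (continuous_spectrum _).continuousOn

variable [NeZero M]

/-- Beyond the diamond the spectra are determined only at the zeros of an entire function of the
frequency. -/
theorem exists_entire_beyond_diamond (hm : 0 < m) (hΔ : 0 < Δ) (hc₀ : 0 < c₀)
    (hper : ∀ n, Function.Periodic (encoder a τ n) ((M * (2 * m) : ℕ) : ℤ)) {E : Set Plane}
    (hE : UniquelyDeterminedOn Δ c₀ a τ E) (hEC : E ⊆ cone c₀) :
    ∃ f : entire, f ≠ 0 ∧ ∀ p ∈ E, c₀ * (1 / (M * Δ)) < |p 0| + c₀ * |p 1| →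
      (f : ℂ → ℂ) (p 0) = 0 := by
  have hM := NeZero.pos M
  have hN : M * (2 * m) ≠ 0 := Nat.mul_ne_zero (NeZero.ne M) (by omega)
  obtain ⟨x, hx0, -, hx⟩ := exists_ne_zero_forall_row (a := a) (τ := τ) (N := M * (2 * m))
    (σ := Fin (2 * m + 1)) (ρ := Fin (M * (2 * m))) (κ := Fin M × Fin (2 * m + 1))
    (by simp only [Fintype.card_fin, Fintype.card_prod]; nlinarith) (fun r => ((r : ℕ) : ℤ))
    (c := id) Function.injective_id (fun i => ((i : ℕ) : ℤ))
  have hc := cancels_of_forall_fin hN hper hx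
  classical
  let S : Finset (Fin (2 * m + 1)) := Finset.univ.filter fun i => ∃ n, x n i ≠ 0
  have hmem : ∀ i, i ∈ S ↔ ∃ n, x n i ≠ 0 := fun i => by simp [S]
  have hS : S.Nonempty := by
    by_contra h
    rw [Finset.not_nonempty_iff_eq_empty] at h
    refine hx0 (funext fun n => funext fun i => by_contra fun hne => ?_)
    have := (hmem i).2 ⟨n, hne⟩
    simp [h] at this
  obtain ⟨n₀, hn₀⟩ := (hmem _).1 (S.min'_mem hS)
  obtain ⟨n₁, hn₁⟩ := (hmem _).1 (S.max'_mem hS)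
  have hpos : 0 < 1 / ((M * (2 * m) : ℕ) * Δ) := spacing_pos hm hΔ
  have hB := two_mul_spacing (M := M) hm hΔ
  have hle : ∀ i j : Fin (2 * m + 1), i ≤ j → 0 ≤ (((j : ℕ) : ℝ) - (i : ℕ)) ∧
      (((j : ℕ) : ℝ) - (i : ℕ)) ≤ 2 * m := by
    intro i j hij
    have h1 : ((i : ℕ) : ℝ) ≤ (j : ℕ) := by exact_mod_cast hij
    have h2 : ((j : ℕ) : ℝ) ≤ 2 * m := by exact_mod_cast Nat.lt_succ_iff.1 j.2
    have h3 : (0 : ℝ) ≤ (i : ℕ) := Nat.cast_nonneg _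
    constructor <;> linarith
  -- The lowest nonzero alias serves points with `p 1 ≤ 0`, as all others then lie above it, toward
  -- the far edge; the highest serves `0 ≤ p 1`. The product covers both.
  refine ⟨x n₀ (S.min' hS) * x n₁ (S.max' hS), mul_ne_zero hn₀ hn₁, fun p hp hlt => ?_⟩
  have hinj : Function.Injective fun i : Fin (2 * m + 1) => ((i : ℕ) : ℤ) :=
    fun i j hij => Fin.ext (by simpa using hij)
  have happ := fun i₀ => hE.apply_eq_zero hc₀ hpos (spacing_mul hm hΔ) hinj hc i₀ hp
  simp only [Int.cast_natCast] at happ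
  have hmul : (((x n₀ (S.min' hS) * x n₁ (S.max' hS) : entire)) : ℂ → ℂ) (p 0) =
    (x n₀ (S.min' hS) : ℂ → ℂ) (p 0) * (x n₁ (S.max' hS) : ℂ → ℂ) (p 0) := rfl
  rw [hmul, mul_eq_zero]
  rcases le_total (p 1) 0 with h | h
  · refine Or.inl (happ _ (fun i n hne => shift_mem_cone hc₀ (hEC hp) hlt (Or.inl ⟨h, ?_⟩)) n₀)
    obtain ⟨h1, h2⟩ := hle _ i (S.min'_le i ((hmem i).2 ⟨n, hne⟩))
    rw [hB]
    exact ⟨mul_nonneg h1 hpos.le, mul_le_mul_of_nonneg_right h2 hpos.le⟩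
  · refine Or.inr (happ _ (fun i n hne => shift_mem_cone hc₀ (hEC hp) hlt (Or.inr ⟨h, ?_⟩)) n₁)
    obtain ⟨h1, h2⟩ := hle i _ (S.le_max' i ((hmem i).2 ⟨n, hne⟩))
    rw [hB]
    have := mul_nonneg h1 hpos.le
    have := mul_le_mul_of_nonneg_right h2 hpos.le
    constructor <;> nlinarith

theorem ae_coord_zero {q : ℝ → Prop} (hq : ∀ᵐ ω : ℝ, q ω) : ∀ᵐ p : Plane, q (p 0) :=
  ((Measure.quasiMeasurePreserving_eval (fun _ : Fin 2 => (volume : Measure ℝ)) 0).comp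
    (EuclideanSpace.volume_preserving_symm_measurableEquiv_toLp (Fin 2)).quasiMeasurePreserving).ae
    hq

theorem ae_line_ne {α β γ : ℝ} (hα : α ≠ 0) : ∀ᵐ p : Plane, α * p 0 + β * p 1 ≠ γ := by
  let ℓ : Plane →ₗ[ℝ] ℝ := α • (EuclideanSpace.proj 0 : Plane →L[ℝ] ℝ).toLinearMap +
    β • (EuclideanSpace.proj 1 : Plane →L[ℝ] ℝ).toLinearMap
  have hℓ : ∀ p, ℓ p = α * p 0 + β * p 1 := fun p => rfl
  have hle : ∀ r, ℓ !₂[r, 0] = α * r := fun r => by simp [hℓ]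
  let S : AffineSubspace ℝ Plane := AffineSubspace.mk' !₂[γ / α, 0] (LinearMap.ker ℓ)
  have hS : ∀ p, p ∈ S ↔ α * p 0 + β * p 1 = γ := fun p => by
    rw [AffineSubspace.mem_mk', vsub_eq_sub, LinearMap.mem_ker, map_sub, hle, hℓ,
      mul_div_cancel₀ _ hα, sub_eq_zero]
  have hne : S ≠ ⊤ := fun h => by
    have h1 := (hS !₂[(γ + 1) / α, 0]).1 (h ▸ AffineSubspace.mem_top _ _ _)
    rw [← hℓ, hle, mul_div_cancel₀ _ hα] at h1
    linarith
  refine measure_mono_null (fun p hp => ?_) (Measure.addHaar_affineSubspace volume S hne)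
  exact (hS p).2 (by simpa using hp)

theorem ae_boundary_ne (b : ℝ) : ∀ᵐ p : Plane, |p 0| + c₀ * |p 1| ≠ b := by
  filter_upwards [ae_line_ne (α := 1) (β := c₀) (γ := b) (by norm_num),
    ae_line_ne (α := 1) (β := -c₀) (γ := b) (by norm_num),
    ae_line_ne (α := -1) (β := c₀) (γ := b) (by norm_num),
    ae_line_ne (α := -1) (β := -c₀) (γ := b) (by norm_num)] with p h1 h2 h3 h4 h
  rcases abs_cases (p 0) with ⟨e0, _⟩ | ⟨e0, _⟩ <;> rcases abs_cases (p 1) with ⟨e1, _⟩ | ⟨e1, _⟩ <;>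
    rw [e0, e1] at h
  · exact h1 (by linarith)
  · exact h2 (by linarith)
  · exact h3 (by linarith)
  · exact h4 (by linarith)

theorem UniquelyDeterminedOn.ae_le_diamond (hm : 0 < m) (hΔ : 0 < Δ) (hc₀ : 0 < c₀)
    (hper : ∀ n, Function.Periodic (encoder a τ n) ((M * (2 * m) : ℕ) : ℤ)) {E : Set Plane}
    (hE : UniquelyDeterminedOn Δ c₀ a τ E) (hEC : E ⊆ cone c₀) :
    E ≤ᵐ[volume] diamond M Δ c₀ := by
  obtain ⟨f, hf, hfE⟩ := exists_entire_beyond_diamond hm hΔ hc₀ hper hE hEC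
  filter_upwards [ae_coord_zero (entire.ae_ne_zero hf),
    ae_boundary_ne (c₀ := c₀) (c₀ * (1 / (M * Δ)))] with p h1 h2 hp
  refine (mem_diamond_iff hΔ hc₀).2 ⟨hEC hp, ?_⟩
  exact lt_of_le_of_ne (not_lt.1 fun h => h1 (hfE p hp h)) h2

theorem isOpen_diamond (hΔ : 0 < Δ) (hc₀ : 0 < c₀) : IsOpen (diamond M Δ c₀) := by
  have : diamond M Δ c₀ = {p : Plane | c₀ * |p 1| < |p 0|} ∩
      {p : Plane | |p 0| + c₀ * |p 1| < c₀ * (1 / (M * Δ))} :=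
    Set.ext fun p => mem_diamond_iff hΔ hc₀
  rw [this]
  exact (isOpen_lt (by fun_prop) (by fun_prop)).inter (isOpen_lt (by fun_prop) (by fun_prop))

theorem volume_diamond_ne_top (hΔ : 0 < Δ) (hc₀ : 0 < c₀) : volume (diamond M Δ c₀) ≠ ⊤ := by
  have hM : (0 : ℝ) < M := Nat.cast_pos.2 (NeZero.pos M)
  have hB : 0 < 1 / (M * Δ) := by positivity
  refine (Bornology.IsBounded.measure_lt_top ?_).ne
  refine (Metric.isBounded_closedBall (x := (0 : Plane))
    (r := (c₀ + 1) * (1 / (M * Δ)))).subset fun p hp => ?_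
  obtain ⟨-, h⟩ := (mem_diamond_iff hΔ hc₀).1 hp
  rw [mem_closedBall_zero_iff]
  have h1 : |p 0| ≤ c₀ * (1 / (M * Δ)) := by nlinarith [abs_nonneg (p 1)]
  have h2 : |p 1| ≤ 1 / (M * Δ) := by
    refine le_of_mul_le_mul_left ?_ hc₀
    linarith [abs_nonneg (p 0)]
  rw [EuclideanSpace.norm_eq, Fin.sum_univ_two]
  refine Real.sqrt_le_iff.2 ⟨by positivity, ?_⟩
  simp only [Real.norm_eq_abs]
  nlinarith [abs_nonneg (p 0), abs_nonneg (p 1), mul_nonneg (abs_nonneg (p 0)) (abs_nonneg (p 1)),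
    pow_le_pow_left₀ (add_nonneg (abs_nonneg (p 0)) (abs_nonneg (p 1)))
      (add_le_add h1 h2) 2]

end measure

end SimSource

/-! ### The theorem -/

open SimSource in
theorem theorem2 (M m : ℕ) [NeZero M] (hm : 0 < m) (Δ c₀ : ℝ) (hΔ : 0 < Δ) (hc₀ : 0 < c₀)
    (a τ : Fin M → ℤ → ℝ)
    (ha : ∀ n j, a n (j + 2 * M * m) = a n j) (hτ : ∀ n j, τ n (j + 2 * M * m) = τ n j)
    (E : Set Plane) (hEm : NullMeasurableSet E volume) (hEC : E ⊆ cone c₀)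
    (hE : UniquelyDeterminedOn Δ c₀ a τ E) :
    volume E ≤ volume (diamond M Δ c₀) ∧
    (volume E = volume (diamond M Δ c₀) →
      E =ᵐ[volume] diamond M Δ c₀ ∧
      E ⊆ closure (diamond M Δ c₀) ∧
      UniquelyDeterminedOn Δ c₀ a τ (diamond M Δ c₀) ∧
      (IsOpen E → (∀ E' : Set Plane, IsOpen E' → E ⊆ E' → E' ⊆ cone c₀ →
          UniquelyDeterminedOn Δ c₀ a τ E' → E' = E) → E = diamond M Δ c₀) ∧
      RelativelyPeriodicEncoding a τ ∧
      ((∀ j, a 0 j = 1) → (∀ j, τ 0 j = 0) → PeriodicEncoding a τ)) := by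
  have hcast : (2 * M * m : ℤ) = ((M * (2 * m) : ℕ) : ℤ) := by push_cast; ring
  rw [hcast] at ha hτ
  have hper := encoder_periodic ha hτ
  have hle := hE.ae_le_diamond hm hΔ hc₀ hper hEC
  refine ⟨measure_mono_ae hle, fun heq => ?_⟩
  have hae : E =ᵐ[volume] diamond M Δ c₀ :=
    ae_eq_of_ae_subset_of_measure_ge hle heq.ge hEm (volume_diamond_ne_top hΔ hc₀)
  have hD := hE.of_ae_eq (isOpen_diamond hΔ hc₀) hae
  have hbd : ∀ p ∈ E, |p 0| + c₀ * |p 1| ≤ c₀ * (1 / (M * Δ)) := fun p hp =>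
    UniquelyDeterminedOn.abs_add_le hm hΔ hc₀ hD hper hE hp (hEC hp)
  have hrel := relativelyPeriodicEncoding hm hΔ hc₀ hD hper
  refine ⟨hae, fun p hp => mem_closure_diamond hΔ hc₀ (hEC hp) (hbd p hp), hD, ?_, hrel, ?_⟩
  · intro hEo hmax
    refine Set.Subset.antisymm (fun p hp => ?_) ?_
    · refine (mem_diamond_iff hΔ hc₀).2 ⟨hEC hp, ?_⟩
      -- An open E contains some `r • p` with r > 1, and the bound there makes the one at `p`
      -- strict.
      have ht : Filter.Tendsto (fun r : ℝ => r • p) (nhdsWithin 1 (Set.Ioi 1)) (nhds p) := by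
        have : Continuous fun r : ℝ => r • p := by fun_prop
        simpa using (this.tendsto 1).mono_left nhdsWithin_le_nhds
      obtain ⟨r, hr, hr1⟩ := ((ht.eventually (hEo.mem_nhds hp)).and self_mem_nhdsWithin).exists
      have h1 : (1 : ℝ) < r := hr1
      have h2 := hbd _ hr
      simp only [PiLp.smul_apply, smul_eq_mul, abs_mul, abs_of_pos (zero_lt_one.trans h1)] at h2
      have h3 : c₀ * |p 1| < |p 0| := hEC hp
      have h4 : 0 ≤ c₀ * |p 1| := by positivity
      nlinarith
    -- Determination passes to unions, so maximality absorbs the diamond.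
    · have := hmax (E ∪ diamond M Δ c₀) (hEo.union (isOpen_diamond hΔ hc₀)) Set.subset_union_left
        (Set.union_subset hEC fun p hp => hp.1) (fun f g hf hg hfg n p hp =>
          hp.elim (hE f g hf hg hfg n p) (hD f g hf hg hfg n p))
      exact Set.union_eq_left.1 this
  · intro ha0 hτ0 n j
    obtain ⟨h1, h2⟩ := hrel n 0 j
    simp only [ha0, hτ0, mul_one, sub_zero] at h1 h2
    exact ⟨h1, h2⟩
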